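/- Let $R$ be a local noetherian ring with maximal ideal $\mathfrak m$ that is formally integral, that is, its formal completion $\hat R=\varprojlim_n R/\mathfrak m^n$ is an integral domain. Let $p\ge 1$ be the characteristic exponent of the field $\operatorname{Frac}(R)\subset\operatorname{Frac}(\hat R)$ (so $p=1$ in characteristic zero, and $p$ is the characteristic otherwise), and let $$R^{\mathrm{prc}}=\{b\in\hat R \mid b^{p^\nu}\in R \text{ for some } \nu\ge 0\}$$ be the $p$-radical closure of $R$, a subring of $\hat R$ containing $R$. Let $R\subset B\subset R^{\mathrm{prc}}$ be an intermediate ring (it is automatically a local domain). Suppose that $B$ is noetherian and that its generic formal fiber $\hat B\otimes_B\operatorname{Frac}(B)$ is reduced, where $\hat B$ is the formal completion of the local ring $B$. If $R$ is a regular local ring, then so is $B$; and if $R$ is Cohen–Macaulay, then so is $B$. -/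

import Mathlib

open IsLocalRing
open scoped TensorProduct

noncomputable section

namespace PRadical

/-- The formal completion of a local ring `R`, that is, the inverse limit of the rings
`R ⧸ 𝔪 ^ n`, where `𝔪` is the maximal ideal. -/
abbrev FormalCompletion (R : Type*) [CommRing R] [IsLocalRing R] : Type _ :=
  AdicCompletion (maximalIdeal R) R

/-- A local ring is formally integral if its formal completion is an integral domain. -/
class IsFormallyIntegral (R : Type*) [CommRing R] [IsLocalRing R] : Prop where
  isDomain_formalCompletion : IsDomain (FormalCompletion R)

attribute [instance] IsFormallyIntegral.isDomain_formalCompletion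

/-- The generic formal fibers of a local ring `R` are reduced: for every minimal prime ideal `𝔭`
with residue field `κ(𝔭)`, the formal fiber ring `R̂ ⊗[R] κ(𝔭)` is reduced.
If `R` is a domain, then `𝔭 = 0` is the only minimal prime, and `κ(𝔭)` is the field of
fractions. -/
def HasReducedGenericFormalFibers (R : Type*) [CommRing R] [IsLocalRing R] : Prop :=
  ∀ (𝔭 : Ideal R) [𝔭.IsPrime], 𝔭 ∈ minimalPrimes R →
    IsReduced (FormalCompletion R ⊗[R] 𝔭.ResidueField)

/-- The characteristic exponent of the field of fractions of the formal completion of `R`: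
it equals `1` in characteristic zero and `p` in characteristic `p > 0`. If `R` is noetherian,
then `R` is a subring of its formal completion, so this is also the characteristic exponent of
the field of fractions of `R`. -/
def charExponent (R : Type*) [CommRing R] [IsLocalRing R] [IsFormallyIntegral R] : ℕ :=
  ringExpChar (FractionRing (FormalCompletion R))

instance (R : Type*) [CommRing R] [IsLocalRing R] [IsFormallyIntegral R] :
    ExpChar (FormalCompletion R) (charExponent R) := by
  have : ExpChar (FractionRing (FormalCompletion R)) (charExponent R) := ringExpChar.expChar _
  exact RingHom.expChar (algebraMap (FormalCompletion R) (FractionRing (FormalCompletion R)))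
    (IsFractionRing.injective _ _) _

/-- The `p`-radical closure of a formally integral local ring `R`: the set of all `b` in the formal
completion such that `b ^ (p ^ ν)` belongs to (the image of) `R` for some `ν ≥ 0`, where `p` is the
characteristic exponent. -/
def pRadicalClosure (R : Type*) [CommRing R] [IsLocalRing R] [IsFormallyIntegral R] :
    Subalgebra R (FormalCompletion R) where
  carrier := {b | ∃ ν : ℕ, b ^ charExponent R ^ ν ∈ (algebraMap R (FormalCompletion R)).range}
  mul_mem' := by
    rintro a b ⟨m, hm⟩ ⟨n, hn⟩
    refine ⟨m + n, ?_⟩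
    rw [mul_pow]
    refine mul_mem ?_ ?_
    · rw [pow_add, pow_mul]
      exact pow_mem hm _
    · rw [add_comm m n, pow_add, pow_mul]
      exact pow_mem hn _
  add_mem' := by
    rintro a b ⟨m, hm⟩ ⟨n, hn⟩
    refine ⟨m + n, ?_⟩
    rw [add_pow_expChar_pow]
    refine add_mem ?_ ?_
    · rw [pow_add, pow_mul]
      exact pow_mem hm _
    · rw [add_comm m n, pow_add, pow_mul]
      exact pow_mem hn _
  algebraMap_mem' r := ⟨0, by simp⟩

/-- Every ring between `R` and its `p`-radical closure is local. -/
instance isLocalRing_intermediate (R : Type*) [CommRing R] [IsLocalRing R] [IsFormallyIntegral R]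
    (B : Subalgebra R (pRadicalClosure R)) : IsLocalRing B := by
  let f : B →ₐ[R] R ⧸ maximalIdeal R :=
    ((AdicCompletion.evalOneₐ (maximalIdeal R)).comp (pRadicalClosure R).val).comp B.val
  have hf : IsLocalHom f.toRingHom := by
    refine ⟨fun b hb ↦ ?_⟩
    obtain ⟨ν, r, hr⟩ := b.1.2
    have h : algebraMap R B r = b ^ charExponent R ^ ν := by
      apply Subtype.ext
      apply Subtype.ext
      exact hr
    have hq : charExponent R ^ ν ≠ 0 :=
      pow_ne_zero _ (expChar_pos (FormalCompletion R) (charExponent R)).ne'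
    have h1 : f (algebraMap R B r) = f b ^ charExponent R ^ ν := by rw [h, map_pow]
    rw [AlgHom.commutes] at h1
    have h2 : IsUnit (algebraMap R (R ⧸ maximalIdeal R) r) := h1 ▸ IsUnit.pow _ hb
    have h3 : IsUnit r := by
      by_contra hcon
      have h0 : algebraMap R (R ⧸ maximalIdeal R) r = 0 :=
        Ideal.Quotient.eq_zero_iff_mem.mpr ((mem_maximalIdeal r).mpr hcon)
      rw [h0] at h2
      exact not_isUnit_zero h2
    exact (isUnit_pow_iff hq).mp (h ▸ h3.map (algebraMap R B))
  have : IsLocalRing (R ⧸ maximalIdeal R) :=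
    .of_surjective' (Ideal.Quotient.mk (maximalIdeal R)) Ideal.Quotient.mk_surjective
  exact f.toRingHom.domain_isLocalRing

/-- The depth of a local ring: the supremum of the lengths of regular sequences contained in the
maximal ideal. -/
def depth (R : Type*) [CommRing R] [IsLocalRing R] : ℕ∞ :=
  ⨆ rs : {rs : List R // (∀ r ∈ rs, r ∈ maximalIdeal R) ∧ RingTheory.Sequence.IsRegular R rs},
    (rs.1.length : ℕ∞)

/-- A local noetherian ring is Cohen-Macaulay if its depth equals its Krull dimension. -/
class IsCohenMacaulayLocalRing (R : Type*) [CommRing R] : Prop extends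
    IsLocalRing R, IsNoetherianRing R where
  depth_eq_ringKrullDim : (depth R : WithBot ℕ∞) = ringKrullDim R

end PRadical

end

noncomputable section

namespace PRadical

/-! Write `S` for the intermediate ring and `ι` for its embedding in the completion R̂. By flatness,
the completion Ŝ embeds in the generic formal fiber, so it is reduced. If elements a_n of `R`
approximate `ι b` in R̂, they define a point y of Ŝ, and some p^ν-th power of y - b vanishes because
b^(p^ν) lies in `R`; hence y = b. So `R` is dense in `S` for the topology of `S` itself
(`sub_algebraMap_mem_maximalIdeal_pow`). With Krull's intersection theorem this gives I R̂ ∩ S = I S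
and 𝔪_R S = 𝔪_S. Dimensions agree, so generators of 𝔪_R settle the regular case; regular sequences
pass from `R` to R̂ by flatness and descend to `S`, which settles the Cohen–Macaulay case. -/

/-- In a local noetherian ring, an element that lies in `J + 𝔪 ^ k` for all `k` lies in `J`. -/
lemma mem_of_forall_exists_sub_mem_pow {S : Type*} [CommRing S] [IsLocalRing S]
    [IsNoetherianRing S] {J : Ideal S} {b : S}
    (h : ∀ k : ℕ, ∃ c ∈ J, b - c ∈ maximalIdeal S ^ k) : b ∈ J := by
  rw [← Ideal.Quotient.eq_zero_iff_mem, ← Submodule.mem_bot S,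
    ← Ideal.iInf_pow_smul_eq_bot_of_isLocalRing (M := S ⧸ J) (maximalIdeal S)
      (Ideal.IsPrime.ne_top inferInstance), Submodule.mem_iInf]
  intro k
  obtain ⟨c, hc, hbc⟩ := h k
  have h1 : Ideal.Quotient.mk J b = (b - c) • (1 : S ⧸ J) := by
    rw [Algebra.smul_def, mul_one, Ideal.Quotient.algebraMap_eq, map_sub,
      Ideal.Quotient.eq_zero_iff_mem.mpr hc, sub_zero]
  rw [h1]
  exact Submodule.smul_mem_smul hbc trivial

/-- A local noetherian domain with reduced generic formal fiber is analytically unramified. -/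
lemma HasReducedGenericFormalFibers.isReduced_formalCompletion {S : Type*} [CommRing S]
    [IsLocalRing S] [IsDomain S] [IsNoetherianRing S] (h : HasReducedGenericFormalFibers S) :
    IsReduced (FormalCompletion S) := by
  have hred := h ⊥ (by simp [IsDomain.minimalPrimes_eq_singleton_bot])
  have hinj : Function.Injective (algebraMap S (⊥ : Ideal S).ResidueField) := by
    rw [RingHom.injective_iff_ker_eq_bot, Ideal.ker_algebraMap_residueField]
  exact isReduced_of_injective
    (Algebra.TensorProduct.includeLeft :
      FormalCompletion S →ₐ[S] FormalCompletion S ⊗[S] (⊥ : Ideal S).ResidueField)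
    (Algebra.TensorProduct.includeLeft_injective hinj)

/-- A regular sequence in the maximal ideal of a local noetherian ring is at most as long as the
Krull dimension. -/
lemma depth_le_ringKrullDim (R : Type*) [CommRing R] [IsLocalRing R] [IsNoetherianRing R] :
    (depth R : WithBot ℕ∞) ≤ ringKrullDim R := by
  obtain ⟨d, hd⟩ := WithBot.ne_bot_iff_exists.mp (ringKrullDim_ne_bot (R := R))
  rw [← hd, WithBot.coe_le_coe]
  refine iSup_le fun ⟨rs, _, hrs⟩ ↦ ?_
  have h := ringKrullDim_add_length_eq_ringKrullDim_of_isRegular rs hrs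
  have : Nontrivial (R ⧸ Ideal.ofList rs) := by
    refine Ideal.Quotient.nontrivial_iff.mpr fun h ↦ hrs.top_ne_smul ?_
    simp [h]
  have h0 : (0 : WithBot ℕ∞) ≤ ringKrullDim (R ⧸ Ideal.ofList rs) := ringKrullDim_nonneg_of_nontrivial
  rw [← WithBot.coe_le_coe, hd, ← h]
  exact le_add_of_nonneg_left h0

section Intermediate

variable {R S : Type*} [CommRing R] [IsLocalRing R] [CommRing S] [Algebra R S]
  {ι : S →ₐ[R] FormalCompletion R}

lemma evalₐ_algebraMap (k : ℕ) (r : R) :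
    AdicCompletion.evalₐ (maximalIdeal R) k (algebraMap R (FormalCompletion R) r) =
      Ideal.Quotient.mk _ r :=
  AdicCompletion.evalₐ_of ..

lemma isLocalHom_of_algHom_formalCompletion (ι : S →ₐ[R] FormalCompletion R) :
    IsLocalHom (algebraMap R S) := by
  refine ⟨fun r hr ↦ ?_⟩
  by_contra hcon
  have h := hr.map ((AdicCompletion.evalOneₐ (maximalIdeal R)).comp ι)
  rw [AlgHom.commutes, Ideal.Quotient.algebraMap_eq,
    Ideal.Quotient.eq_zero_iff_mem.mpr ((mem_maximalIdeal r).mpr hcon)] at h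
  exact not_isUnit_zero h

lemma algebraMap_injective_of_algHom_formalCompletion [IsNoetherianRing R]
    (ι : S →ₐ[R] FormalCompletion R) : Function.Injective (algebraMap R S) := by
  have : IsHausdorff (maximalIdeal R) R :=
    .of_isLocalRing _ _ (Ideal.IsPrime.ne_top inferInstance)
  refine Function.Injective.of_comp (f := ι) ?_
  rw [← AlgHom.coe_toRingHom, ← RingHom.coe_comp, AlgHom.comp_algebraMap]
  exact AdicCompletion.of_injective _ _

lemma expChar_of_algHom_formalCompletion [IsFormallyIntegral R] (hι : Function.Injective ι) :
    ExpChar S (charExponent R) :=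
  RingHom.expChar ι.toRingHom hι _

/-- A purely inseparable extension induces a homeomorphism on spectra. -/
lemma ringKrullDim_eq_of_algHom_formalCompletion [IsNoetherianRing R] [IsFormallyIntegral R]
    (ι : S →ₐ[R] FormalCompletion R)
    (hrad : ∀ b : S, ∃ ν : ℕ, b ^ charExponent R ^ ν ∈ (algebraMap R S).range) :
    ringKrullDim R = ringKrullDim S := by
  rw [← PrimeSpectrum.topologicalKrullDim_eq_ringKrullDim R,
    ← PrimeSpectrum.topologicalKrullDim_eq_ringKrullDim S]
  refine (IsHomeomorph.topologicalKrullDim_eq _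
    (PrimeSpectrum.isHomeomorph_comap (algebraMap R S) (fun b ↦ ?_) ?_)).symm
  · obtain ⟨ν, hν⟩ := hrad b
    exact ⟨_, expChar_pow_pos (FormalCompletion R) (charExponent R) ν, hν⟩
  · rw [(RingHom.injective_iff_ker_eq_bot _).mp
      (algebraMap_injective_of_algHom_formalCompletion ι)]
    exact bot_le

lemma map_maximalIdeal_pow_le [IsLocalRing S] (ι : S →ₐ[R] FormalCompletion R) (k : ℕ) :
    maximalIdeal R ^ k ≤ (maximalIdeal S ^ k).comap (algebraMap R S) := by
  have := isLocalHom_of_algHom_formalCompletion ι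
  rw [← Ideal.map_le_iff_le_comap, Ideal.map_pow]
  exact Ideal.pow_right_mono (map_maximalIdeal_le _) k

variable [IsLocalRing S] [IsFormallyIntegral R]

/-- If the formal completion of a purely inseparable extension `S` of `R` inside the formal
completion of `R` is reduced, then the `𝔪`-adic approximations of `b : S` by elements of `R`
converge to `b` in the topology of `S`. -/
lemma sub_algebraMap_mem_maximalIdeal_pow [IsReduced (FormalCompletion S)]
    (hι : Function.Injective ι)
    (hrad : ∀ b : S, ∃ ν : ℕ, b ^ charExponent R ^ ν ∈ (algebraMap R S).range)
    {b : S} {k : ℕ} {r : R}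
    (hr : AdicCompletion.evalₐ (maximalIdeal R) k (ι b) = Ideal.Quotient.mk _ r) :
    b - algebraMap R S r ∈ maximalIdeal S ^ k := by
  have := expChar_of_algHom_formalCompletion hι
  obtain ⟨a, hab⟩ := AdicCompletion.mk_surjective _ _ (ι b)
  have ha (n : ℕ) : Ideal.Quotient.mk _ (a n) = AdicCompletion.evalₐ (maximalIdeal R) n (ι b) := by
    rw [← hab, AdicCompletion.evalₐ_mk]
  let y : FormalCompletion S := AdicCompletion.mk _ _ (AdicCompletion.AdicCauchySequence.mk _ _
    (fun n ↦ algebraMap R S (a n)) fun m ↦ by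
      have h : a m ≡ a (m + 1) [SMOD (maximalIdeal R ^ m • ⊤ : Ideal R)] := a.2 m.le_succ
      rw [SModEq.sub_mem, smul_eq_mul, Ideal.mul_top] at h ⊢
      rw [← map_sub]
      exact map_maximalIdeal_pow_le ι m h)
  have hy (n : ℕ) : AdicCompletion.evalₐ (maximalIdeal S) n
      (y - algebraMap S (FormalCompletion S) b) =
        Ideal.Quotient.mk _ (algebraMap R S (a n) - b) := by
    rw [map_sub, map_sub, AdicCompletion.evalₐ_mk, evalₐ_algebraMap]
    rfl
  -- Modulo 𝔪_S^n, Frobenius turns the power of y - b into the image of a_n^(p^ν) - s, which already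
  -- lies in 𝔪_R^n since s = b^(p^ν) in R̂.
  have hy0 : y - algebraMap S (FormalCompletion S) b = 0 := by
    obtain ⟨ν, s, hs⟩ := hrad b
    refine pow_eq_zero_iff (expChar_pow_pos S (charExponent R) ν).ne' |>.mp ?_
    refine AdicCompletion.ext_evalₐ fun n ↦ ?_
    rw [map_pow, hy, ← map_pow, sub_pow_expChar_pow, ← hs, ← map_pow, ← map_sub, map_zero,
      Ideal.Quotient.eq_zero_iff_mem]
    refine map_maximalIdeal_pow_le ι n ?_
    rw [← Ideal.Quotient.eq_zero_iff_mem, map_sub, map_pow, ha, ← map_pow, ← map_pow, ← hs,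
      AlgHom.commutes, evalₐ_algebraMap, sub_self]
  have h1 : algebraMap R S (a k) - b ∈ maximalIdeal S ^ k := by
    rw [← Ideal.Quotient.eq_zero_iff_mem, ← hy, hy0, map_zero]
  have h2 : a k - r ∈ maximalIdeal R ^ k := by
    rw [← Ideal.Quotient.eq_zero_iff_mem, map_sub, ha, hr, sub_self]
  have h3 := sub_mem (Ideal.mem_comap.mp (map_maximalIdeal_pow_le ι k h2)) h1
  rw [map_sub] at h3
  convert h3 using 1
  ring

/-- If the formal completion of `S` is reduced, every ideal `I` of `R` satisfies
`I R̂ ∩ S = I S`. -/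
lemma mem_map_of_mem_map_formalCompletion [IsNoetherianRing S] [IsReduced (FormalCompletion S)]
    (hι : Function.Injective ι)
    (hrad : ∀ b : S, ∃ ν : ℕ, b ^ charExponent R ^ ν ∈ (algebraMap R S).range)
    {I : Ideal R} {b : S} (hb : ι b ∈ I.map (algebraMap R (FormalCompletion R))) :
    b ∈ I.map (algebraMap R S) := by
  refine mem_of_forall_exists_sub_mem_pow fun k ↦ ?_
  -- Modulo 𝔪_R^k, the class of `ι b` comes from `I`, so the approximation can be chosen in `I`.
  let e : FormalCompletion R →+* R ⧸ maximalIdeal R ^ k := AdicCompletion.evalₐ (maximalIdeal R) k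
  have hcomp : e.comp (algebraMap R (FormalCompletion R)) = Ideal.Quotient.mk _ :=
    RingHom.ext fun r ↦ evalₐ_algebraMap k r
  have h := Ideal.mem_map_of_mem e hb
  rw [Ideal.map_map, hcomp] at h
  obtain ⟨r, hrI, hr⟩ := (Ideal.mem_map_iff_of_surjective _ Ideal.Quotient.mk_surjective).mp h
  exact ⟨algebraMap R S r, Ideal.mem_map_of_mem _ hrI,
    sub_algebraMap_mem_maximalIdeal_pow hι hrad hr.symm⟩

lemma map_maximalIdeal_eq [IsNoetherianRing S] [IsReduced (FormalCompletion S)]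
    (hι : Function.Injective ι)
    (hrad : ∀ b : S, ∃ ν : ℕ, b ^ charExponent R ^ ν ∈ (algebraMap R S).range) :
    (maximalIdeal R).map (algebraMap R S) = maximalIdeal S := by
  have hloc := isLocalHom_of_algHom_formalCompletion ι
  refine le_antisymm (map_maximalIdeal_le _) fun b hb ↦
    mem_of_forall_exists_sub_mem_pow fun k ↦ ?_
  -- Precision k + 1 keeps the exponent positive, so that r ≡ b modulo 𝔪_S and hence r ∈ 𝔪_R, even
  -- for k = 0.
  obtain ⟨r, hr⟩ := Ideal.Quotient.mk_surjective
    (AdicCompletion.evalₐ (maximalIdeal R) (k + 1) (ι b))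
  have h := sub_algebraMap_mem_maximalIdeal_pow hι hrad hr.symm
  refine ⟨algebraMap R S r, Ideal.mem_map_of_mem _ ?_, Ideal.pow_le_pow_right k.le_succ h⟩
  have h1 : algebraMap R S r ∈ maximalIdeal S :=
    (Submodule.sub_mem_iff_right _ hb).mp (Ideal.pow_le_self k.succ_ne_zero h)
  rwa [← maximalIdeal_comap (algebraMap R S)]

theorem isRegularLocalRing_of_algHom_formalCompletion [IsNoetherianRing R] [IsNoetherianRing S]
    [IsReduced (FormalCompletion S)] (hR : IsRegularLocalRing R) (hι : Function.Injective ι)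
    (hrad : ∀ b : S, ∃ ν : ℕ, b ^ charExponent R ^ ν ∈ (algebraMap R S).range) :
    IsRegularLocalRing S := by
  refine .of_spanFinrank_maximalIdeal_le _ ?_
  rw [← ringKrullDim_eq_of_algHom_formalCompletion ι hrad,
    ← hR.spanFinrank_maximalIdeal, ← map_maximalIdeal_eq hι hrad]
  exact_mod_cast Ideal.spanFinrank_map_le_of_fg _ (IsNoetherian.noetherian _)

open RingTheory.Sequence in
lemma isWeaklyRegular_of_algHom_formalCompletion [IsNoetherianRing R] [IsNoetherianRing S]
    [IsReduced (FormalCompletion S)] (hι : Function.Injective ι)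
    (hrad : ∀ b : S, ∃ ν : ℕ, b ^ charExponent R ^ ν ∈ (algebraMap R S).range)
    {rs : List R} (hrs : IsWeaklyRegular R rs) :
    IsWeaklyRegular S rs := by
  have h : IsWeaklyRegular (FormalCompletion R) rs :=
    (isWeaklyRegular_map_algebraMap_iff _ _ rs).mp hrs.of_flat
  refine ⟨fun i hi ↦ ?_⟩
  set I := Ideal.ofList (rs.take i)
  have hle : (I • ⊤ : Submodule R S) ≤ (I • ⊤ : Submodule R (FormalCompletion R)).comap ι.toLinearMap :=
    Submodule.smul_top_le_comap_smul_top I ι.toLinearMap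
  refine (h.regular_mod_prev i hi).of_injective (Submodule.mapQ _ _ ι.toLinearMap hle) ?_
  -- Injectivity of S/IS → R̂/IR̂ is exactly I R̂ ∩ S = I S.
  rw [← LinearMap.ker_eq_bot, Submodule.mapQ, Submodule.ker_liftQ_eq_bot']
  refine le_antisymm (by rwa [LinearMap.ker_comp, Submodule.ker_mkQ]) ?_
  rw [LinearMap.ker_comp, Submodule.ker_mkQ]
  intro b hb
  rw [Ideal.smul_top_eq_map] at hb ⊢
  exact mem_map_of_mem_map_formalCompletion hι hrad hb

theorem isCohenMacaulayLocalRing_of_algHom_formalCompletion [IsNoetherianRing R]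
    [IsNoetherianRing S] [IsReduced (FormalCompletion S)] (hR : IsCohenMacaulayLocalRing R)
    (hι : Function.Injective ι)
    (hrad : ∀ b : S, ∃ ν : ℕ, b ^ charExponent R ^ ν ∈ (algebraMap R S).range) :
    IsCohenMacaulayLocalRing S := by
  have hloc := isLocalHom_of_algHom_formalCompletion ι
  refine { depth_eq_ringKrullDim := le_antisymm (depth_le_ringKrullDim S) ?_ }
  rw [← ringKrullDim_eq_of_algHom_formalCompletion ι hrad,
    ← hR.depth_eq_ringKrullDim, WithBot.coe_le_coe]
  refine iSup_le fun ⟨rs, hmem, hrs⟩ ↦ ?_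
  have hmem' : ∀ s ∈ rs.map (algebraMap R S), s ∈ maximalIdeal S := by
    intro s hs
    obtain ⟨r, hr, rfl⟩ := List.mem_map.mp hs
    exact map_maximalIdeal_le _ (Ideal.mem_map_of_mem _ (hmem r hr))
  have hreg : RingTheory.Sequence.IsRegular S (rs.map (algebraMap R S)) :=
    .of_isWeaklyRegular_of_mem_maximalIdeal _ hmem'
      ((RingTheory.Sequence.isWeaklyRegular_map_algebraMap_iff _ _ rs).mpr
        (isWeaklyRegular_of_algHom_formalCompletion hι hrad hrs.toIsWeaklyRegular))
  refine le_iSup_of_le ⟨rs.map (algebraMap R S), hmem', hreg⟩ ?_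
  simp

end Intermediate

end PRadical

end

theorem corollary3p8 (R : Type*) [CommRing R] [IsLocalRing R] [IsNoetherianRing R]
    [PRadical.IsFormallyIntegral R]
    (B : Subalgebra R (PRadical.pRadicalClosure R)) [IsNoetherianRing B]
    (hfib : PRadical.HasReducedGenericFormalFibers B) :
    (IsRegularLocalRing R → IsRegularLocalRing B) ∧
      (PRadical.IsCohenMacaulayLocalRing R → PRadical.IsCohenMacaulayLocalRing B) := by
  let ι : B →ₐ[R] PRadical.FormalCompletion R := (PRadical.pRadicalClosure R).val.comp B.val
  have hι : Function.Injective ι := Subtype.val_injective.comp Subtype.val_injective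
  have hrad (b : B) : ∃ ν : ℕ, b ^ PRadical.charExponent R ^ ν ∈ (algebraMap R B).range := by
    obtain ⟨ν, r, hr⟩ := b.1.2
    exact ⟨ν, r, hι hr⟩
  have : IsReduced (PRadical.FormalCompletion B) := hfib.isReduced_formalCompletion
  exact ⟨fun hR ↦ PRadical.isRegularLocalRing_of_algHom_formalCompletion hR hι hrad,
    fun hR ↦ PRadical.isCohenMacaulayLocalRing_of_algHom_formalCompletion hR hι hrad⟩
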